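/- For $\rho\in\mathbb R$ let $\mathbb H_\rho=\{s\in\mathbb C:\Re(s)>\rho\}$. Let $\mathbf a=(a_{m,n})_{m,n=1}^\infty$ be a matrix of complex numbers such that the double Dirichlet series $\sum_{m,n\ge 1}a_{m,n}m^{-s}n^{-u}$ is regularly convergent at every $(s,u)\in\mathbb H_\rho\times\mathbb H_\rho$; that is, the rectangular partial sums $\sum_{m\le M}\sum_{n\le N}a_{m,n}m^{-s}n^{-u}$ converge as $M,N\to\infty$ independently, the series $\sum_{m\ge1}a_{m,n}m^{-s}$ converges for every $n\ge 1$, and the series $\sum_{n\ge1}a_{m,n}n^{-u}$ converges for every $m\ge1$. Let $\kappa_{\mathbf a}:\mathbb H_\rho\times\mathbb H_\rho\to\mathbb C$, $$\kappa_{\mathbf a}(s,u)=\sum_{m,n=1}^\infty a_{m,n}m^{-s}n^{-\bar u},$$ be the Dirichlet series kernel with coefficient matrix $\mathbf a$. Let $\mathrm{Aut}_L(\mathbb H_\rho)$ be the subgroup of the group of biholomorphic self-maps of $\mathbb H_\rho$ that consists of the maps $$\phi_A(s)=\frac{a(s-\rho)-ib}{d}+\rho,\qquad A=\begin{pmatrix}a&b\\0&d\end{pmatrix}\in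 \mathrm{SL}_2(\mathbb R).$$ If $\kappa_{\mathbf a}$ is non-constant, then $\kappa_{\mathbf a}$ is not $\mathrm{Aut}_L(\mathbb H_\rho)$-invariant; that is, it is not the case that $\kappa_{\mathbf a}(\phi(s),\phi(u))=\kappa_{\mathbf a}(s,u)$ for all $\phi\in\mathrm{Aut}_L(\mathbb H_\rho)$ and all $s,u\in\mathbb H_\rho$. -/

import Mathlib

open Filter Topology
open scoped MatrixGroups

/-- The open right half-plane `{s ∈ ℂ : Re s > ρ}`. -/
def rightHalfPlane (ρ : ℝ) : Set ℂ := {s : ℂ | ρ < s.re}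

/-! ### Double Dirichlet series and Dirichlet series kernels -/

/-- The rectangular partial sum `∑_{m ≤ M} ∑_{n ≤ N} a_{m,n} m^{-s} n^{-u}` of a double
Dirichlet series, where `p = (M, N)`. -/
noncomputable def doubleDirichletPartialSum (a : ℕ+ → ℕ+ → ℂ) (s u : ℂ) (p : ℕ+ × ℕ+) : ℂ :=
  ∑ m ∈ Finset.Icc 1 p.1, ∑ n ∈ Finset.Icc 1 p.2, a m n * (m : ℂ) ^ (-s) * (n : ℂ) ^ (-u)

/-- Hardy's regular convergence at `(s, u)`: the double series converges (its rectangular partial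
sums have a limit as both bounds tend to infinity independently), and so does every one of
its columns and rows, as an ordinary (possibly conditionally convergent) series. -/
def RegularlyConvergentAt (a : ℕ+ → ℕ+ → ℂ) (s u : ℂ) : Prop :=
  (∃ L : ℂ, Tendsto (doubleDirichletPartialSum a s u) atTop (𝓝 L)) ∧
  (∀ n : ℕ+, ∃ L : ℂ,
    Tendsto (fun M : ℕ+ => ∑ m ∈ Finset.Icc 1 M, a m n * (m : ℂ) ^ (-s)) atTop (𝓝 L)) ∧
  (∀ m : ℕ+, ∃ L : ℂ,
    Tendsto (fun N : ℕ+ => ∑ n ∈ Finset.Icc 1 N, a m n * (n : ℂ) ^ (-u)) atTop (𝓝 L))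

/-- The matrix `a` is the coefficient matrix of a Dirichlet series kernel on
`rightHalfPlane ρ × rightHalfPlane ρ`: the double Dirichlet series
`∑ a_{m,n} m^{-s} n^{-u}` is regularly convergent at every point of that product. -/
def IsDirichletSeriesKernelOn (a : ℕ+ → ℕ+ → ℂ) (ρ : ℝ) : Prop :=
  ∀ s ∈ rightHalfPlane ρ, ∀ u ∈ rightHalfPlane ρ, RegularlyConvergentAt a s u

/-- The kernel `κ_a(s, u) = ∑_{m,n} a_{m,n} m^{-s} n^{-ū}` on
`rightHalfPlane ρ × rightHalfPlane ρ`; the sum of the double series is the limit of its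
rectangular partial sums, which exists whenever `IsDirichletSeriesKernelOn a ρ` holds. -/
noncomputable def dirichletSeriesKernel (a : ℕ+ → ℕ+ → ℂ) (ρ : ℝ)
    (s u : rightHalfPlane ρ) : ℂ :=
  limUnder atTop (doubleDirichletPartialSum a (s : ℂ) (starRingEnd ℂ (u : ℂ)))

/-! ### Automorphisms of a right half-plane -/

/-- A self-map of `Ω ⊆ ℂ` is holomorphic if it is the restriction of a function that is complex
differentiable on `Ω`. -/
def IsHolomorphicSelfMap (Ω : Set ℂ) (g : Ω → Ω) : Prop :=
  ∃ f : ℂ → ℂ, DifferentiableOn ℂ f Ω ∧ ∀ z : Ω, f z = g z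

theorem IsHolomorphicSelfMap.comp {Ω : Set ℂ} {g h : Ω → Ω} (hg : IsHolomorphicSelfMap Ω g)
    (hh : IsHolomorphicSelfMap Ω h) : IsHolomorphicSelfMap Ω (g ∘ h) := by
  obtain ⟨f, hf, hfg⟩ := hg
  obtain ⟨k, hk, hkh⟩ := hh
  refine ⟨f ∘ k, hf.comp hk ?_, fun z => ?_⟩
  · intro z hz
    rw [hkh ⟨z, hz⟩]
    exact (h ⟨z, hz⟩).2
  · simp [hkh z, hfg]

/-- The group `Aut(Ω)` of biholomorphic self-maps of `Ω`, under composition. -/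
def holAut (Ω : Set ℂ) : Subgroup (Equiv.Perm Ω) where
  carrier := {g | IsHolomorphicSelfMap Ω g ∧ IsHolomorphicSelfMap Ω g.symm}
  one_mem' := ⟨⟨id, differentiableOn_id, fun _ => rfl⟩, ⟨id, differentiableOn_id, fun _ => rfl⟩⟩
  mul_mem' := fun hg hh => ⟨hg.1.comp hh.1, hh.2.comp hg.2⟩
  inv_mem' := fun hg => ⟨hg.2, hg.1⟩

/-- The formula `φ_A(s) = (a (s - ρ) - i b) / (i c (s - ρ) + d) + ρ` for a real matrix
`A = (a b; c d)` of determinant one. -/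
noncomputable def phiFun (ρ : ℝ) (A : SL(2, ℝ)) (s : ℂ) : ℂ :=
  ((A 0 0 : ℂ) * (s - ρ) - Complex.I * (A 0 1 : ℂ)) /
    (Complex.I * (A 1 0 : ℂ) * (s - ρ) + (A 1 1 : ℂ)) + ρ

theorem phiFun_denom_ne_zero {ρ : ℝ} (A : SL(2, ℝ)) {s : ℂ} (hs : s ∈ rightHalfPlane ρ) :
    Complex.I * (A 1 0 : ℂ) * (s - ρ) + (A 1 1 : ℂ) ≠ 0 := by
  intro h
  have hs' : ρ < s.re := hs
  have hdet := A.det_coe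
  rw [Matrix.det_fin_two] at hdet
  have him := congrArg Complex.im h
  have hre := congrArg Complex.re h
  simp at him hre
  have hc : A 1 0 = 0 := by
    rcases him with h1 | h1
    · exact h1
    · linarith
  have hd : A 1 1 = 0 := by simpa [hc] using hre
  simp [hc, hd] at hdet

theorem phiFun_mem {ρ : ℝ} (A : SL(2, ℝ)) {s : ℂ} (hs : s ∈ rightHalfPlane ρ) :
    phiFun ρ A s ∈ rightHalfPlane ρ := by
  have hne := phiFun_denom_ne_zero A hs
  have hs' : ρ < s.re := hs
  have hdet := A.det_coe
  rw [Matrix.det_fin_two] at hdet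
  have hpos := Complex.normSq_pos.mpr hne
  have key : (phiFun ρ A s).re - ρ = (s.re - ρ) /
      Complex.normSq (Complex.I * (A 1 0 : ℂ) * (s - ρ) + (A 1 1 : ℂ)) := by
    rw [phiFun, Complex.add_re, Complex.div_re, Complex.ofReal_re, add_sub_cancel_right,
      ← add_div]
    congr 1
    simp
    linear_combination (s.re - ρ) * hdet
  have : 0 < (phiFun ρ A s).re - ρ := by
    rw [key]
    exact div_pos (by linarith) hpos
  show ρ < (phiFun ρ A s).re
  linarith

theorem phiFun_one (ρ : ℝ) (s : ℂ) : phiFun ρ 1 s = s := by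
  simp [phiFun]

theorem phiFun_mul {ρ : ℝ} (A B : SL(2, ℝ)) {s : ℂ} (hs : s ∈ rightHalfPlane ρ) :
    phiFun ρ (A * B) s = phiFun ρ A (phiFun ρ B s) := by
  have h1 := phiFun_denom_ne_zero B hs
  simp only [phiFun, add_sub_cancel_right, Matrix.SpecialLinearGroup.coe_mul, Matrix.mul_apply,
    Fin.sum_univ_two, Complex.ofReal_add, Complex.ofReal_mul] at h1 ⊢
  congr 1
  rw [← mul_div_mul_right _ (Complex.I * (A 1 0 : ℂ) * _ + _) h1]
  congr 1
  · rw [sub_mul, mul_assoc (A 0 0 : ℂ), div_mul_cancel₀ _ h1]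
    linear_combination (A 0 1 : ℂ) * (B 1 0 : ℂ) * (s - ρ) * Complex.I_sq
  · rw [add_mul, mul_assoc (Complex.I * (A 1 0 : ℂ)), div_mul_cancel₀ _ h1]
    linear_combination (A 1 0 : ℂ) * (B 0 1 : ℂ) * Complex.I_sq

theorem phiFun_differentiableOn (ρ : ℝ) (A : SL(2, ℝ)) :
    DifferentiableOn ℂ (phiFun ρ A) (rightHalfPlane ρ) := by
  unfold phiFun
  refine DifferentiableOn.add_const _ (DifferentiableOn.div (by fun_prop) (by fun_prop) ?_)
  intro s hs
  exact phiFun_denom_ne_zero A hs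

/-- The biholomorphic self-map `φ_A` of the right half-plane; its inverse is `φ_{A⁻¹}`. -/
noncomputable def phi (ρ : ℝ) (A : SL(2, ℝ)) : holAut (rightHalfPlane ρ) :=
  ⟨{ toFun := fun s => ⟨phiFun ρ A s, phiFun_mem A s.2⟩
     invFun := fun s => ⟨phiFun ρ A⁻¹ s, phiFun_mem A⁻¹ s.2⟩
     left_inv := fun s => Subtype.ext (by
       show phiFun ρ A⁻¹ (phiFun ρ A s) = s
       rw [← phiFun_mul A⁻¹ A s.2, inv_mul_cancel, phiFun_one])
     right_inv := fun s => Subtype.ext (by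
       show phiFun ρ A (phiFun ρ A⁻¹ s) = s
       rw [← phiFun_mul A A⁻¹ s.2, mul_inv_cancel, phiFun_one]) },
    ⟨phiFun ρ A, phiFun_differentiableOn ρ A, fun _ => rfl⟩,
    ⟨phiFun ρ A⁻¹, phiFun_differentiableOn ρ A⁻¹, fun _ => rfl⟩⟩

theorem phi_one (ρ : ℝ) : phi ρ 1 = 1 := by
  apply Subtype.ext
  ext s
  exact phiFun_one ρ s

theorem phi_mul (ρ : ℝ) (A B : SL(2, ℝ)) : phi ρ (A * B) = phi ρ A * phi ρ B := by
  apply Subtype.ext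
  ext s
  exact phiFun_mul A B s.2

theorem phi_inv (ρ : ℝ) (A : SL(2, ℝ)) : phi ρ A⁻¹ = (phi ρ A)⁻¹ := by
  rw [eq_inv_iff_mul_eq_one, ← phi_mul, inv_mul_cancel, phi_one]

/-- The subgroup `Aut_L` of linear automorphisms of the right half-plane: all `φ_A` with
`A = (a b; 0 d)` real of determinant one. -/
noncomputable def linearAut (ρ : ℝ) : Subgroup (holAut (rightHalfPlane ρ)) where
  carrier := {g | ∃ A : SL(2, ℝ), A 1 0 = 0 ∧ phi ρ A = g}
  one_mem' := ⟨1, by simp, phi_one ρ⟩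
  mul_mem' := by
    rintro _ _ ⟨A, hA, rfl⟩ ⟨B, hB, rfl⟩
    refine ⟨A * B, ?_, phi_mul ρ A B⟩
    simp [Matrix.mul_apply, Fin.sum_univ_two, hA, hB]
  inv_mem' := by
    rintro _ ⟨A, hA, rfl⟩
    refine ⟨A⁻¹, ?_, phi_inv ρ A⟩
    simp [Matrix.SpecialLinearGroup.coe_inv, Matrix.adjugate_fin_two, hA]

/-! ### Invariant and constant kernels -/

/-- A kernel `κ` on `X` is `G`-invariant if `κ(g · s, g · u) = κ(s, u)` for all `g ∈ G` and
all `s, u ∈ X`. -/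
def IsInvariantKernel (G : Type*) {X : Type*} [Group G] [MulAction G X] (κ : X → X → ℂ) : Prop :=
  ∀ (g : G) (s u : X), κ (g • s) (g • u) = κ s u

/-- A kernel is constant if it takes a single value on `X × X`. -/
def IsConstantKernel {X : Type*} (κ : X → X → ℂ) : Prop :=
  ∃ c : ℂ, ∀ s u : X, κ s u = c

/-! The dilations `s ↦ e^{2t}(s - ρ) + ρ` belong to `linearAut ρ` and push both arguments of the
kernel towards real part `+∞`, where every term except the one with `m = n = 1` dies out. An
invariant kernel is constant along these orbits, so each of its values equals the limit `a 1 1`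
(`tendsto_dirichletSeriesKernel`). The analytic point is to pass to the limit termwise although
convergence may be conditional. Regular convergence bounds the terms at one real point `σ`, so `a m
n` is `O(m^σ n^σ)`. Two units further right the series is dominated by `∑ m⁻² n⁻²`, and dominated
convergence applies. -/

/-- A sequence indexed by `ℕ+` with bounded partial sums is bounded. -/
theorem norm_le_two_mul_of_norm_sum_Icc_le {g : ℕ+ → ℂ} {C : ℝ}
    (h : ∀ M : ℕ+, ‖∑ m ∈ Finset.Icc 1 M, g m‖ ≤ C) (m : ℕ+) : ‖g m‖ ≤ 2 * C := by
  have hC : 0 ≤ C := (norm_nonneg _).trans (h 1)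
  induction m using PNat.recOn with
  | one => simpa using (h 1).trans (by linarith : C ≤ 2 * C)
  | succ p _ =>
    have hI : Finset.Icc 1 (p + 1) = insert (p + 1) (Finset.Icc 1 p) := by
      ext x
      simp only [Finset.mem_insert, Finset.mem_Icc, ← PNat.coe_le_coe, ← PNat.coe_inj, PNat.add_coe, PNat.one_coe]
      omega
    have hn : p + 1 ∉ Finset.Icc 1 p := by
      simp
    have hs := h (p + 1)
    rw [hI, Finset.sum_insert hn] at hs
    calc ‖g (p + 1)‖ = ‖(g (p + 1) + ∑ m ∈ Finset.Icc 1 p, g m)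
          - ∑ m ∈ Finset.Icc 1 p, g m‖ := by rw [add_sub_cancel_right]
      _ ≤ C + C := (norm_sub_le _ _).trans (add_le_add hs (h p))
      _ = 2 * C := by ring

theorem exists_norm_le_of_tendsto_pnat {g : ℕ+ → ℂ} {L : ℂ} (h : Tendsto g atTop (𝓝 L)) :
    ∃ C, ∀ m, ‖g m‖ ≤ C := by
  obtain ⟨C, hC⟩ := (Metric.isBounded_range_of_tendsto _
    (h.comp OrderIso.pnatIsoNat.symm.tendsto_atTop)).exists_norm_le
  refine ⟨C, fun m => hC _ ⟨OrderIso.pnatIsoNat m, by simp⟩⟩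

/-- The terms of a regularly convergent double series are bounded. -/
theorem exists_norm_le_of_regularly_convergent {f : ℕ+ → ℕ+ → ℂ} {L : ℂ}
    (h : Tendsto (fun p : ℕ+ × ℕ+ => ∑ m ∈ Finset.Icc 1 p.1, ∑ n ∈ Finset.Icc 1 p.2, f m n)
      atTop (𝓝 L))
    (hcol : ∀ n, ∃ L : ℂ, Tendsto (fun M => ∑ m ∈ Finset.Icc 1 M, f m n) atTop (𝓝 L))
    (hrow : ∀ m, ∃ L : ℂ, Tendsto (fun N => ∑ n ∈ Finset.Icc 1 N, f m n) atTop (𝓝 L)) :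
    ∃ C, ∀ m n, ‖f m n‖ ≤ C := by
  choose c hc using hcol
  choose r hr using hrow
  -- Convergence of the rows bounds all rectangles of fixed height `M`, uniformly in `N`; below, the
  -- columns do the same for fixed `N`.
  choose A hA using fun M : ℕ+ => exists_norm_le_of_tendsto_pnat
    (tendsto_finsetSum (Finset.Icc 1 M) fun m _ => hr m)
  choose B hB using fun N : ℕ+ => exists_norm_le_of_tendsto_pnat
    (tendsto_finsetSum (Finset.Icc 1 N) fun n _ => hc n)
  obtain ⟨⟨K₁, K₂⟩, hK⟩ := eventually_atTop.1 (h.norm.eventually_le_const (lt_add_one ‖L‖))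
  have hA0 : ∀ M, 0 ≤ A M := fun M => (norm_nonneg _).trans (hA M 1)
  have hB0 : ∀ N, 0 ≤ B N := fun N => (norm_nonneg _).trans (hB N 1)
  -- Beyond `(K₁, K₂)` the rectangular sums are near `L`; the other rectangles lie in finitely many
  -- strips `M ≤ K₁` or `N ≤ K₂`.
  set D : ℝ := (‖L‖ + 1) + ∑ M ∈ Finset.Icc 1 K₁, A M + ∑ N ∈ Finset.Icc 1 K₂, B N
  have hSA := Finset.sum_nonneg fun M (_ : M ∈ Finset.Icc 1 K₁) => hA0 M
  have hSB := Finset.sum_nonneg fun N (_ : N ∈ Finset.Icc 1 K₂) => hB0 N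
  have hL := norm_nonneg L
  have hS : ∀ N M : ℕ+, ‖∑ m ∈ Finset.Icc 1 M, ∑ n ∈ Finset.Icc 1 N, f m n‖ ≤ D := by
    intro N M
    by_cases hM : M ≤ K₁
    · have h1 := Finset.single_le_sum (fun M _ => hA0 M)
        (Finset.mem_Icc.2 ⟨one_le, hM⟩)
      linarith [hA M N]
    by_cases hN : N ≤ K₂
    · have h1 := Finset.single_le_sum (fun N _ => hB0 N)
        (Finset.mem_Icc.2 ⟨one_le, hN⟩)
      rw [Finset.sum_comm]
      linarith [hB N M]
    · linarith [hK (M, N) ⟨(not_le.1 hM).le, (not_le.1 hN).le⟩]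
  -- Differencing in `M` bounds the partial sums of each row by `2 * D`; differencing in `N` then
  -- bounds the terms.
  exact ⟨2 * (2 * D), fun m => norm_le_two_mul_of_norm_sum_Icc_le
    fun N => norm_le_two_mul_of_norm_sum_Icc_le (hS N) m⟩

theorem norm_pnat_cpow (m : ℕ+) (s : ℂ) : ‖(m : ℂ) ^ s‖ = (m : ℝ) ^ s.re :=
  Complex.norm_natCast_cpow_of_pos m.pos s

theorem summable_pnat_rpow_neg_two : Summable fun m : ℕ+ => (m : ℝ) ^ (-2 : ℝ) :=
  (Real.summable_nat_rpow.2 (by norm_num : (-2 : ℝ) < -1)).comp_injective PNat.coe_injective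

/-- The coefficients of a double Dirichlet series that converges regularly at a point grow at
most polynomially. -/
theorem RegularlyConvergentAt.exists_norm_coeff_le {a : ℕ+ → ℕ+ → ℂ} {σ : ℝ}
    (h : RegularlyConvergentAt a σ σ) :
    ∃ C, ∀ m n, ‖a m n‖ ≤ C * (m : ℝ) ^ σ * (n : ℝ) ^ σ := by
  obtain ⟨⟨L, hL⟩, hcol, hrow⟩ := h
  obtain ⟨C, hC⟩ := exists_norm_le_of_regularly_convergent hL
    (fun n => by
      obtain ⟨l, hl⟩ := hcol n
      exact ⟨_, by simpa only [Finset.sum_mul] using hl.mul_const ((n : ℂ) ^ (-(σ : ℂ)))⟩)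
    (fun m => by
      obtain ⟨l, hl⟩ := hrow m
      refine ⟨_, (hl.mul_const ((m : ℂ) ^ (-(σ : ℂ)))).congr fun N => ?_⟩
      rw [Finset.sum_mul]
      exact Finset.sum_congr rfl fun n _ => by ring)
  refine ⟨C, fun m n => ?_⟩
  have hm : (0 : ℝ) < m := by exact_mod_cast m.pos
  have hn : (0 : ℝ) < n := by exact_mod_cast n.pos
  have := hC m n
  rw [norm_mul, norm_mul, norm_pnat_cpow, norm_pnat_cpow, Complex.neg_re, Complex.ofReal_re,
    Real.rpow_neg hm.le, Real.rpow_neg hn.le, ← div_eq_mul_inv, ← div_eq_mul_inv,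
    div_le_iff₀ (by positivity), div_le_iff₀ (by positivity)] at this
  linarith

/-- The majorant does not depend on `s` and `u`: this gives both absolute convergence and the
domination needed for the limit. -/
theorem norm_term_le {a : ℕ+ → ℕ+ → ℂ} {σ C : ℝ}
    (hC : ∀ m n, ‖a m n‖ ≤ C * (m : ℝ) ^ σ * (n : ℝ) ^ σ) {s u : ℂ}
    (hs : σ + 2 ≤ s.re) (hu : σ + 2 ≤ u.re) (p : ℕ+ × ℕ+) :
    ‖a p.1 p.2 * (p.1 : ℂ) ^ (-s) * (p.2 : ℂ) ^ (-u)‖ ≤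
      C * ((p.1 : ℝ) ^ (-2 : ℝ) * (p.2 : ℝ) ^ (-2 : ℝ)) := by
  have hC0 : 0 ≤ C := by simpa using (norm_nonneg _).trans (hC 1 1)
  have key : ∀ (m : ℕ+) {z : ℂ}, σ + 2 ≤ z.re →
      (m : ℝ) ^ σ * (m : ℝ) ^ (-z).re ≤ (m : ℝ) ^ (-2 : ℝ) := by
    intro m z hz
    rw [← Real.rpow_add (by exact_mod_cast m.pos)]
    refine Real.rpow_le_rpow_of_exponent_le (by exact_mod_cast one_le (a := m)) ?_
    rw [Complex.neg_re]
    linarith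
  rw [norm_mul, norm_mul, norm_pnat_cpow, norm_pnat_cpow]
  calc _ ≤ C * (p.1 : ℝ) ^ σ * (p.2 : ℝ) ^ σ * (p.1 : ℝ) ^ (-s).re * (p.2 : ℝ) ^ (-u).re := by
        gcongr
        exact hC _ _
    _ = C * (((p.1 : ℝ) ^ σ * (p.1 : ℝ) ^ (-s).re) * ((p.2 : ℝ) ^ σ * (p.2 : ℝ) ^ (-u).re)) := by
        ring
    _ ≤ _ := by
        gcongr
        · exact key _ hs
        · exact key _ hu

/-- Rectangles are cofinal among finite sets of pairs, so an unconditional sum can be computed along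
them. -/
theorem tendsto_Icc_product_atTop :
    Tendsto (fun p : ℕ+ × ℕ+ => Finset.Icc 1 p.1 ×ˢ Finset.Icc 1 p.2) atTop atTop := by
  refine tendsto_atTop_finset_of_monotone (fun p q hpq => ?_) fun p => ⟨p, by simp⟩
  exact Finset.product_subset_product (Finset.Icc_subset_Icc le_rfl hpq.1)
    (Finset.Icc_subset_Icc le_rfl hpq.2)

/-- An absolutely convergent double Dirichlet series converges to its unconditional sum. -/
theorem tendsto_doubleDirichletPartialSum_tsum {a : ℕ+ → ℕ+ → ℂ} {s u : ℂ}
    (h : Summable fun p : ℕ+ × ℕ+ => a p.1 p.2 * (p.1 : ℂ) ^ (-s) * (p.2 : ℂ) ^ (-u)) :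
    Tendsto (doubleDirichletPartialSum a s u) atTop
      (𝓝 (∑' p : ℕ+ × ℕ+, a p.1 p.2 * (p.1 : ℂ) ^ (-s) * (p.2 : ℂ) ^ (-u))) :=
  (h.hasSum.comp tendsto_Icc_product_atTop).congr fun p => by
    simp [doubleDirichletPartialSum, Finset.sum_product]

theorem tendsto_pnat_cpow_neg {ι : Type*} {l : Filter ι} {s : ι → ℂ}
    (hs : Tendsto (fun i => (s i).re) l atTop) (m : ℕ+) :
    Tendsto (fun i => (m : ℂ) ^ (-s i)) l (𝓝 (if m = 1 then 1 else 0)) := by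
  split_ifs with hm
  · simpa [hm] using tendsto_const_nhds
  · rw [tendsto_zero_iff_norm_tendsto_zero]
    simp only [norm_pnat_cpow, Complex.neg_re]
    have h : 1 < m := one_le.lt_of_ne (Ne.symm hm)
    have h1 : (1 : ℝ) < m := by exact_mod_cast h
    exact (tendsto_rpow_atBot_of_base_gt_one _ h1).comp (tendsto_neg_atTop_atBot.comp hs)

/-- A Dirichlet series kernel tends to its leading coefficient as the real parts of both
arguments tend to infinity. -/
theorem tendsto_dirichletSeriesKernel {a : ℕ+ → ℕ+ → ℂ} {ρ : ℝ}
    (ha : IsDirichletSeriesKernelOn a ρ) {ι : Type*} {l : Filter ι} [l.IsCountablyGenerated]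
    {s u : ι → rightHalfPlane ρ}
    (hs : Tendsto (fun i => (s i : ℂ).re) l atTop) (hu : Tendsto (fun i => (u i : ℂ).re) l atTop) :
    Tendsto (fun i => dirichletSeriesKernel a ρ (s i) (u i)) l (𝓝 (a 1 1)) := by
  -- Any real point of the half-plane would serve as `σ`; here it is `ρ + 1`.
  have hmem : ((ρ + 1 : ℝ) : ℂ) ∈ rightHalfPlane ρ := by
    show ρ < ((ρ + 1 : ℝ) : ℂ).re
    rw [Complex.ofReal_re]
    linarith
  obtain ⟨C, hC⟩ := (ha _ hmem _ hmem).exists_norm_coeff_le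
  have hsum : Summable fun p : ℕ+ × ℕ+ => C * ((p.1 : ℝ) ^ (-2 : ℝ) * (p.2 : ℝ) ^ (-2 : ℝ)) :=
    (summable_pnat_rpow_neg_two.mul_of_nonneg summable_pnat_rpow_neg_two
      (fun _ => by positivity) (fun _ => by positivity)).mul_left C
  have hbd : ∀ᶠ i in l, ∀ p : ℕ+ × ℕ+,
      ‖a p.1 p.2 * (p.1 : ℂ) ^ (-(s i : ℂ)) * (p.2 : ℂ) ^ (-starRingEnd ℂ (u i : ℂ))‖ ≤
        C * ((p.1 : ℝ) ^ (-2 : ℝ) * (p.2 : ℝ) ^ (-2 : ℝ)) := by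
    filter_upwards [hs.eventually_ge_atTop (ρ + 1 + 2), hu.eventually_ge_atTop (ρ + 1 + 2)]
      with i hi hi'
    exact norm_term_le hC hi (by rwa [Complex.conj_re])
  have hlim := tendsto_tsum_of_dominated_convergence hsum
    (fun p : ℕ+ × ℕ+ => ((tendsto_pnat_cpow_neg hs p.1).const_mul (a p.1 p.2)).mul
      (tendsto_pnat_cpow_neg (s := fun i => starRingEnd ℂ (u i : ℂ)) (by simpa using hu) p.2)) hbd
  rw [tsum_eq_single (1, 1)] at hlim
  · simp only [if_true, mul_one] at hlim
    refine hlim.congr' ?_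
    filter_upwards [hbd] with i hi
    exact (tendsto_doubleDirichletPartialSum_tsum
      (Summable.of_norm_bounded hsum hi)).limUnder_eq.symm
  · rintro ⟨m, n⟩ hmn
    by_cases hm : m = 1
    · have hn : n ≠ 1 := fun hn => hmn (by rw [hm, hn])
      simp [hn]
    · simp [hm]

/-- The diagonal matrix `(eᵗ 0; 0 e⁻ᵗ)`. -/
noncomputable def expDiag (t : ℝ) : SL(2, ℝ) :=
  ⟨!![Real.exp t, 0; 0, Real.exp (-t)], by simp [Matrix.det_fin_two, ← Real.exp_add]⟩

theorem phiFun_expDiag_re (ρ t : ℝ) (s : ℂ) :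
    (phiFun ρ (expDiag t) s).re = Real.exp (2 * t) * (s.re - ρ) + ρ := by
  have h : phiFun ρ (expDiag t) s = (Real.exp (2 * t) : ℂ) * (s - ρ) + ρ := by
    -- The multiplier of the dilation is the quotient of the diagonal entries `eᵗ` and `e⁻ᵗ`.
    have h2 : (Real.exp (2 * t) : ℂ) = Real.exp t / Real.exp (-t) := by
      rw [← Complex.ofReal_div, ← Real.exp_sub]
      ring_nf
    rw [h2]
    simp only [phiFun, expDiag, Matrix.of_apply, Matrix.cons_val', Matrix.cons_val_zero,
      Matrix.cons_val_one, Matrix.cons_val_fin_one, Complex.ofReal_zero, mul_zero, zero_mul,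
      sub_zero, zero_add]
    ring
  simp [h, -Complex.ofReal_exp]

theorem tendsto_phiFun_expDiag_re {ρ : ℝ} {s : ℂ} (hs : s ∈ rightHalfPlane ρ) :
    Tendsto (fun t => (phiFun ρ (expDiag t) s).re) atTop atTop := by
  simp only [phiFun_expDiag_re]
  have hpos : 0 < s.re - ρ := sub_pos.2 hs
  exact tendsto_atTop_add_const_right _ _ (((Real.tendsto_exp_atTop.comp
    (tendsto_id.const_mul_atTop two_pos)).atTop_mul_const hpos))

theorem corollary4p7 (ρ : ℝ) (a : ℕ+ → ℕ+ → ℂ) (ha : IsDirichletSeriesKernelOn a ρ)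
    (hconst : ¬ IsConstantKernel (dirichletSeriesKernel a ρ)) :
    ¬ IsInvariantKernel (linearAut ρ) (dirichletSeriesKernel a ρ) := by
  intro hinv
  refine hconst ⟨a 1 1, fun s u => ?_⟩
  let g (t : ℝ) : linearAut ρ := ⟨phi ρ (expDiag t), expDiag t, by simp [expDiag], rfl⟩
  have hlim := tendsto_dirichletSeriesKernel ha (s := fun t => g t • s) (u := fun t => g t • u)
    (tendsto_phiFun_expDiag_re s.2) (tendsto_phiFun_expDiag_re u.2)
  -- By invariance the function of `t` converging to `a 1 1` is constantly the kernel's value at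
  -- `(s, u)`.
  exact tendsto_nhds_unique tendsto_const_nhds (hlim.congr fun t => hinv (g t) s u)
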